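/- Rings are associative with unit, ring homomorphisms preserve the unit, and $\operatorname{Mod} A$ denotes the category of right $A$-modules. Let $A$ be a (right) hereditary ring, that is, $\operatorname{Ext}_A^n(X,Y)=0$ for all right $A$-modules $X,Y$ and all $n>1$. Let $\mathcal Y$ be an abelian subcategory of $\operatorname{Mod} A$, that is, a full subcategory, closed under isomorphic objects, which is abelian as a category and whose inclusion functor $\mathcal Y\to\operatorname{Mod} A$ is exact. Suppose that $\mathcal Y$ is closed under extensions, under arbitrary (set-indexed) products and under arbitrary (set-indexed) coproducts in $\operatorname{Mod} A$. Then there exist a ring $B$ and a homological epimorphism $f\colon A\to B$, that is, a ring homomorphism such that multiplication induces an isomorphism $B\otimes_A B\xrightarrow{\sim} B$ and $\operatorname{Tor}_n^A(B,B)=0$ for all $n>0$, such that the restriction functor $\operatorname{Mod} B\to\operatorname{Mod} A$ along $f$ takes values in $\mathcal Y$ and induces an equivalence $\operatorname{Mod} B\xrightarrow{\sim}\mathcal Y$. -/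

import Mathlib

open CategoryTheory CategoryTheory.Limits
open scoped TensorProduct MulOpposite

universe u

namespace HomologicalEpi

noncomputable section

/-- A full subcategory `P` of an abelian category `C` is an abelian subcategory if it is replete,
it is abelian as a category, and its inclusion functor into `C` is exact. -/
structure IsAbelianSubcategory {C : Type*} [Category* C] [Abelian C] (P : ObjectProperty C) :
    Prop where
  isClosedUnderIsomorphisms : P.IsClosedUnderIsomorphisms
  nonempty_abelian : Nonempty (Abelian P.FullSubcategory)
  preservesFiniteLimits : PreservesFiniteLimits P.ι
  preservesFiniteColimits : PreservesFiniteColimits P.ι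

/-- The ring `A` is right hereditary: `Ext_A^n(X, Y) = 0` for all right `A`-modules `X`, `Y` and
all `n > 1`. Right `A`-modules are modules over the opposite ring. -/
def IsRightHereditary (A : Type u) [Ring A] : Prop :=
  ∀ (X Y : ModuleCat.{u} Aᵐᵒᵖ) (n : ℕ), 1 < n → Subsingleton (Abelian.Ext.{u} X Y n)

section Tensor

variable {A : Type u} [Ring A]

/-- The subgroup of `M ⊗_ℤ N` generated by the elements `(m a) ⊗ n - m ⊗ (a n)`, for a right
`A`-module `M` and a left `A`-module `N`. -/
def tensorRelations (M : ModuleCat.{u} Aᵐᵒᵖ) (N : ModuleCat.{u} A) : Submodule ℤ (M ⊗[ℤ] N) :=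
  Submodule.span ℤ
    {t | ∃ (m : M) (a : A) (n : N), t = (MulOpposite.op a • m) ⊗ₜ[ℤ] n - m ⊗ₜ[ℤ] (a • n)}

/-- The tensor product `M ⊗_A N` of a right `A`-module `M` and a left `A`-module `N`. -/
abbrev Tensor (M : ModuleCat.{u} Aᵐᵒᵖ) (N : ModuleCat.{u} A) : Type u :=
  (M ⊗[ℤ] N) ⧸ tensorRelations M N

lemma tensorRelations_le_comap {M M' : ModuleCat.{u} Aᵐᵒᵖ} (g : M ⟶ M') (N : ModuleCat.{u} A) :
    tensorRelations M N ≤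
      (tensorRelations M' N).comap
        (LinearMap.rTensor N g.hom.toAddMonoidHom.toIntLinearMap) := by
  refine Submodule.span_le.2 ?_
  rintro _ ⟨m, a, n, rfl⟩
  refine Submodule.subset_span ⟨g.hom m, a, n, ?_⟩
  simp

/-- The map `g ⊗_A N : M ⊗_A N → M' ⊗_A N` induced by a map `g : M → M'` of right `A`-modules. -/
def Tensor.map {M M' : ModuleCat.{u} Aᵐᵒᵖ} (g : M ⟶ M') (N : ModuleCat.{u} A) :
    Tensor M N →ₗ[ℤ] Tensor M' N :=
  Submodule.mapQ _ _ (LinearMap.rTensor N g.hom.toAddMonoidHom.toIntLinearMap)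
    (tensorRelations_le_comap g N)

lemma Tensor.hom_ext {M : ModuleCat.{u} Aᵐᵒᵖ} {N : ModuleCat.{u} A} {T : Type u} [AddCommGroup T]
    {p q : Tensor M N →ₗ[ℤ] T}
    (h : ∀ (m : M) (n : N), p (Submodule.Quotient.mk (m ⊗ₜ[ℤ] n)) =
      q (Submodule.Quotient.mk (m ⊗ₜ[ℤ] n))) : p = q :=
  Submodule.linearMap_qext _ (TensorProduct.ext' h)

lemma Tensor.map_mk {M M' : ModuleCat.{u} Aᵐᵒᵖ} (g : M ⟶ M') (N : ModuleCat.{u} A)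
    (m : M) (n : N) :
    Tensor.map g N (Submodule.Quotient.mk (m ⊗ₜ[ℤ] n)) =
      Submodule.Quotient.mk (g.hom m ⊗ₜ[ℤ] n) := rfl

/-- The functor `- ⊗_A N` from right `A`-modules to abelian groups. -/
def tensorFunctor (N : ModuleCat.{u} A) : ModuleCat.{u} Aᵐᵒᵖ ⥤ ModuleCat.{u} ℤ where
  obj M := ModuleCat.of ℤ (Tensor M N)
  map g := ModuleCat.ofHom (Tensor.map g N)
  map_id _ := ModuleCat.hom_ext (Tensor.hom_ext fun _ _ => rfl)
  map_comp _ _ := ModuleCat.hom_ext (Tensor.hom_ext fun _ _ => rfl)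

instance (N : ModuleCat.{u} A) : (tensorFunctor N).Additive where
  map_add {M M' g h} := by
    refine ModuleCat.hom_ext (Tensor.hom_ext fun m n => ?_)
    change Tensor.map (g + h) N _ = Tensor.map g N _ + Tensor.map h N _
    rw [Tensor.map_mk, Tensor.map_mk, Tensor.map_mk, ModuleCat.hom_add, LinearMap.add_apply,
      TensorProduct.add_tmul, Submodule.Quotient.mk_add]

/-- `Tor_n^A(M, N)`, the `n`-th left derived functor of `- ⊗_A N` evaluated at `M`. -/
def Tor (n : ℕ) (M : ModuleCat.{u} Aᵐᵒᵖ) (N : ModuleCat.{u} A) : ModuleCat.{u} ℤ :=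
  ((tensorFunctor N).leftDerived n).obj M

end Tensor

section RingHom

variable {A B : Type u} [Ring A] [Ring B] (f : A →+* B)

/-- Restriction of right modules `Mod B ⥤ Mod A` along a ring homomorphism `f : A → B`. -/
abbrev restriction : ModuleCat.{u} Bᵐᵒᵖ ⥤ ModuleCat.{u} Aᵐᵒᵖ :=
  ModuleCat.restrictScalars (RingHom.op f)

/-- `B` as a right `A`-module, `b · a = b f(a)`. -/
abbrev rightModule : ModuleCat.{u} Aᵐᵒᵖ := (restriction f).obj (ModuleCat.of Bᵐᵒᵖ B)

/-- `B` as a left `A`-module, `a · b = f(a) b`. -/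
abbrev leftModule : ModuleCat.{u} A := (ModuleCat.restrictScalars f).obj (ModuleCat.of B B)

/-- The map `B ⊗_A B → B`, `x ⊗ y ↦ x y`. -/
def multiplication : Tensor (rightModule f) (leftModule f) →ₗ[ℤ] B :=
  Submodule.liftQ _ (LinearMap.mul' ℤ B : B ⊗[ℤ] B →ₗ[ℤ] B) (by
    refine Submodule.span_le.2 ?_
    rintro _ ⟨x, a, y, rfl⟩
    have key : ∀ b b' : B,
        LinearMap.mul' ℤ B ((b * f a) ⊗ₜ[ℤ] b' - b ⊗ₜ[ℤ] (f a * b')) = 0 := fun b b' => by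
      rw [map_sub, LinearMap.mul'_apply, LinearMap.mul'_apply, mul_assoc, sub_self]
    exact key x y)

/-- A ring homomorphism `f : A → B` is a homological epimorphism if multiplication induces an
isomorphism `B ⊗_A B ≅ B` and `Tor_n^A(B, B) = 0` for all `n > 0`. -/
structure IsHomologicalEpimorphism : Prop where
  bijective_multiplication : Function.Bijective (multiplication f)
  isZero_tor : ∀ n : ℕ, 0 < n → IsZero (Tor n (rightModule f) (leftModule f))

end RingHom

end

end HomologicalEpi

namespace HomologicalEpi

/-! It suffices to reflect the single module `A` into `Y`: to find `B` in `Y` with an element `1`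
such that each element of a module in `Y` is the image of `1` under a unique map from `B`
(`IsReflection`).

Existence rests on a solution set. A pure submodule of a module in `Y` is an equalizer of two maps
into a reduced power, hence in `Y` (`of_isPureSubmodule`), and each element lies in a pure submodule
whose size is bounded in terms of `A`. This gives a weakly initial pointed module, and the
intersection of its submodules in `Y` through the point is initial (`exists_initial`).

Evaluation at `1` identifies `Hom_A(B, X)` with `X` for `X` in `Y`. So `B` is its own endomorphism
ring and modules in `Y` are `B`-modules; conversely, `B`-modules are cokernels of maps between
direct sums of copies of `B`, hence in `Y`.

For every abelian group `T` the `B`-module `Hom_ℤ(B, T)` is therefore in `Y`. By tensor-hom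
adjunction the claims on `B ⊗_A B` and `Tor` reduce to `Hom_A(B, E) = E` and `Ext_A^n(B, E) = 0` for
`E` in `Y`, `n > 0`. The latter follows from closure under extensions for `n = 1` and from heredity
for `n > 1`. -/

/-- A property of modules that is invariant under isomorphism and closed under equalizers,
cokernels, products and direct sums of copies of a module. -/
structure IsClosedUnderConstructions {R : Type u} [Ring R] (P : ObjectProperty (ModuleCat.{u} R)) :
    Prop where
  equiv {M N : Type u} [AddCommGroup M] [Module R M] [AddCommGroup N] [Module R N] (e : M ≃ₗ[R] N)
    (h : P (ModuleCat.of R M)) : P (ModuleCat.of R N)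
  eqLocus {M N : Type u} [AddCommGroup M] [Module R M] [AddCommGroup N] [Module R N]
    (f g : M →ₗ[R] N) (hM : P (ModuleCat.of R M)) (hN : P (ModuleCat.of R N)) :
    P (ModuleCat.of R (LinearMap.eqLocus f g))
  quotient_range {M N : Type u} [AddCommGroup M] [Module R M] [AddCommGroup N] [Module R N]
    (f : M →ₗ[R] N) (hM : P (ModuleCat.of R M)) (hN : P (ModuleCat.of R N)) :
    P (ModuleCat.of R (N ⧸ LinearMap.range f))
  pi {ι : Type u} (M : ι → Type u) [∀ i, AddCommGroup (M i)] [∀ i, Module R (M i)]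
    (h : ∀ i, P (ModuleCat.of R (M i))) : P (ModuleCat.of R (∀ i, M i))
  finsupp (ι : Type u) {M : Type u} [AddCommGroup M] [Module R M]
    (h : P (ModuleCat.of R M)) : P (ModuleCat.of R (ι →₀ M))

/-! ### Closure properties of abelian subcategories. -/

section Closure

variable {R : Type u} [Ring R] {P : ObjectProperty (ModuleCat.{u} R)}

lemma isClosedUnderConstructions_of_isAbelianSubcategory (hP : IsAbelianSubcategory P)
    (hprod : ∀ J : Type u, P.IsClosedUnderLimitsOfShape (Discrete J))
    (hcoprod : ∀ J : Type u, P.IsClosedUnderColimitsOfShape (Discrete J)) :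
    IsClosedUnderConstructions P := by
  have := hP.isClosedUnderIsomorphisms
  have := hP.preservesFiniteLimits
  have := hP.preservesFiniteColimits
  have hlim : HasFiniteLimits P.FullSubcategory := by
    obtain ⟨h⟩ := hP.nonempty_abelian
    infer_instance
  have hcolim : HasFiniteColimits P.FullSubcategory := by
    obtain ⟨h⟩ := hP.nonempty_abelian
    infer_instance
  refine ⟨fun e h => P.prop_of_iso e.toModuleIso h, ?_, ?_, ?_, ?_⟩
  · intro M N _ _ _ _ f g hM hN
    let f' : (⟨ModuleCat.of R M, hM⟩ : P.FullSubcategory) ⟶ ⟨ModuleCat.of R N, hN⟩ :=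
      P.homMk (ModuleCat.ofHom f)
    let g' : (⟨ModuleCat.of R M, hM⟩ : P.FullSubcategory) ⟶ ⟨ModuleCat.of R N, hN⟩ :=
      P.homMk (ModuleCat.ofHom g)
    let e : P.ι.obj (equalizer f' g') ≅ equalizer (ModuleCat.ofHom f) (ModuleCat.ofHom g) :=
      PreservesEqualizer.iso P.ι f' g'
    have h := P.prop_of_iso e (equalizer f' g').property
    let k : equalizer (ModuleCat.ofHom f) (ModuleCat.ofHom g) ⟶ ModuleCat.of R M := equalizer.ι _ _
    have hk : ∀ x, k.hom x ∈ LinearMap.eqLocus f g := fun x =>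
      congr($(equalizer.condition (ModuleCat.ofHom f) (ModuleCat.ofHom g)).hom x)
    let l : ModuleCat.of R (LinearMap.eqLocus f g) ⟶
        equalizer (ModuleCat.ofHom f) (ModuleCat.ofHom g) :=
      equalizer.lift (ModuleCat.ofHom (LinearMap.eqLocus f g).subtype)
        (ModuleCat.hom_ext (LinearMap.ext fun x => x.2))
    have hl : l ≫ k = ModuleCat.ofHom (LinearMap.eqLocus f g).subtype := equalizer.lift_ι _ _
    let k' : equalizer (ModuleCat.ofHom f) (ModuleCat.ofHom g) ⟶
        ModuleCat.of R (LinearMap.eqLocus f g) := ModuleCat.ofHom (k.hom.codRestrict _ hk)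
    refine P.prop_of_iso (X := equalizer (ModuleCat.ofHom f) (ModuleCat.ofHom g)) ⟨k', l, ?_, ?_⟩ h
    · refine equalizer.hom_ext ?_
      change (k' ≫ l) ≫ k = 𝟙 _ ≫ k
      rw [Category.assoc, hl, Category.id_comp]
      rfl
    · refine ModuleCat.hom_ext (LinearMap.ext fun x => Subtype.ext ?_)
      exact congr($(hl).hom x)
  · intro M N _ _ _ _ f hM hN
    let f' : (⟨ModuleCat.of R M, hM⟩ : P.FullSubcategory) ⟶ ⟨ModuleCat.of R N, hN⟩ :=
      P.homMk (ModuleCat.ofHom f)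
    let g' : (⟨ModuleCat.of R M, hM⟩ : P.FullSubcategory) ⟶ ⟨ModuleCat.of R N, hN⟩ :=
      P.homMk (ModuleCat.ofHom 0)
    let e : coequalizer (ModuleCat.ofHom f) (ModuleCat.ofHom 0) ≅ P.ι.obj (coequalizer f' g') :=
      PreservesCoequalizer.iso P.ι f' g'
    have h := P.prop_of_iso e.symm (coequalizer f' g').property
    refine P.prop_of_iso (X := coequalizer (ModuleCat.ofHom f) (ModuleCat.ofHom 0)) ?_ h
    have hz : (ModuleCat.ofHom (0 : M →ₗ[R] N)) = 0 := rfl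
    exact (eqToIso (by simp only [hz]) : coequalizer (ModuleCat.ofHom f)
      (ModuleCat.ofHom (0 : M →ₗ[R] N)) ≅ cokernel (ModuleCat.ofHom f)) ≪≫
      ModuleCat.cokernelIsoRangeQuotient _
  · intro ι M _ _ h
    have := hprod ι
    exact P.prop_of_iso (ModuleCat.piIsoPi fun i => ModuleCat.of R (M i)) (P.prop_pi _ h)
  · intro ι M _ _ h
    have := hcoprod ι
    classical
    have h' : P (∐ fun _ : ι => ModuleCat.of R M) := P.prop_colimit _ fun _ => h
    refine P.prop_of_iso (ModuleCat.coprodIsoDirectSum (fun _ : ι => ModuleCat.of R M) ≪≫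
      (LinearEquiv.toModuleIso (finsuppLequivDFinsupp R).symm)) h'

namespace IsClosedUnderConstructions

variable {M N : Type u} [AddCommGroup M] [Module R M] [AddCommGroup N] [Module R N]

lemma ker (hP : IsClosedUnderConstructions P) (f : M →ₗ[R] N) (hM : P (ModuleCat.of R M))
    (hN : P (ModuleCat.of R N)) : P (ModuleCat.of R (LinearMap.ker f)) :=
  hP.equiv (LinearEquiv.ofEq (LinearMap.eqLocus f 0) _ rfl) (hP.eqLocus f 0 hM hN)

lemma range (hP : IsClosedUnderConstructions P) (f : M →ₗ[R] N) (hM : P (ModuleCat.of R M))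
    (hN : P (ModuleCat.of R N)) : P (ModuleCat.of R (LinearMap.range f)) :=
  hP.equiv (LinearEquiv.ofEq _ _ (Submodule.ker_mkQ _))
    (hP.ker (LinearMap.range f).mkQ hN (hP.quotient_range f hM hN))

lemma quotient (hP : IsClosedUnderConstructions P) (K : Submodule R N)
    (hK : P (ModuleCat.of R K)) (hN : P (ModuleCat.of R N)) : P (ModuleCat.of R (N ⧸ K)) :=
  hP.equiv (Submodule.quotEquivOfEq _ _ K.range_subtype) (hP.quotient_range K.subtype hK hN)

lemma iInf (hP : IsClosedUnderConstructions P) {ι : Type u} (K : ι → Submodule R N)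
    (hK : ∀ i, P (ModuleCat.of R (K i))) (hN : P (ModuleCat.of R N)) :
    P (ModuleCat.of R (⨅ i, K i : Submodule R N)) :=
  hP.equiv (LinearEquiv.ofEq _ _ (by simp [LinearMap.ker_pi]))
    (hP.ker (LinearMap.pi fun i => (K i).mkQ) hN
      (hP.pi _ fun i => hP.quotient (K i) (hK i) hN))

end IsClosedUnderConstructions

end Closure

/-! ### Reduced powers. -/

section ReducedPower

variable (R : Type u) [Ring R] (M : Type u) [AddCommGroup M] [Module R M] (J : Type u)
  [Preorder J] [IsDirectedOrder J] [Nonempty J]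

/-- The submodule of families indexed by a directed preorder that vanish eventually. -/
def eventuallyZero : Submodule R (J → M) where
  carrier := {x | ∃ j, ∀ k, j ≤ k → x k = 0}
  zero_mem' := ⟨Classical.arbitrary J, fun _ _ => rfl⟩
  add_mem' := by
    rintro x y ⟨j, hj⟩ ⟨k, hk⟩
    obtain ⟨l, hjl, hkl⟩ := exists_ge_ge j k
    exact ⟨l, fun m hm => by simp [hj m (hjl.trans hm), hk m (hkl.trans hm)]⟩
  smul_mem' := by
    rintro r x ⟨j, hj⟩
    exact ⟨j, fun m hm => by simp [hj m hm]⟩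

variable {R M J}

lemma IsClosedUnderConstructions.reducedPower {P : ObjectProperty (ModuleCat.{u} R)}
    (hP : IsClosedUnderConstructions P) (hM : P (ModuleCat.of R M)) :
    P (ModuleCat.of R ((J → M) ⧸ eventuallyZero R M J)) := by
  classical
  -- `t j` erases the coordinates from `j` on, so the eventually zero families are the image of a
  -- direct sum of copies of `J → M`.
  let t (j : J) : (J → M) →ₗ[R] (J → M) :=
    LinearMap.pi fun k => if j ≤ k then 0 else LinearMap.proj k
  let F : (J →₀ (J → M)) →ₗ[R] (J → M) := Finsupp.lsum ℕ t
  have hpow := hP.pi (fun _ : J => M) fun _ => hM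
  have hF : LinearMap.range F = eventuallyZero R M J := by
    refine le_antisymm ?_ ?_
    · rintro _ ⟨x, rfl⟩
      rw [Finsupp.lsum_apply]
      refine Submodule.sum_mem _ fun j _ => ⟨j, fun k hk => ?_⟩
      simp [t, hk]
    · rintro x ⟨j, hj⟩
      refine ⟨Finsupp.single j x, funext fun k => ?_⟩
      by_cases hk : j ≤ k
      · simp [F, t, hk, hj k hk]
      · simp [F, t, hk]
  exact hP.equiv (Submodule.quotEquivOfEq _ _ hF)
    (hP.quotient_range F (hP.finsupp J hpow) hpow)

end ReducedPower

/-! ### Pure submodules as equalizers. -/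

section Pure

variable {R : Type u} [Ring R] {M : Type u} [AddCommGroup M] [Module R M]

/-- A submodule `N` of `M` is pure if each finite system of linear equations with constants in `N`
that is solvable in `M` is solvable in `N`. -/
def IsPureSubmodule (N : Submodule R M) : Prop :=
  ∀ (E : Finset ((ℕ →₀ R) × M)), (∀ e ∈ E, e.2 ∈ N) →
    (∃ v : ℕ → M, ∀ e ∈ E, Finsupp.linearCombination R v e.1 = e.2) →
    ∃ v : ℕ → M, (∀ i, v i ∈ N) ∧ ∀ e ∈ E, Finsupp.linearCombination R v e.1 = e.2

/-- The finitely many elements of `M` that occur serve as unknowns, renamed by natural numbers; the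
identity assignment solves the system in `M`. -/
lemma IsPureSubmodule.exists_solution {N : Submodule R M} (hN : IsPureSubmodule N)
    (E : Finset (M →₀ R)) (hE : ∀ e ∈ E, Finsupp.linearCombination R id e ∈ N) :
    ∃ h : M → M, (∀ x, h x ∈ N) ∧
      ∀ e ∈ E, Finsupp.linearCombination R h e = Finsupp.linearCombination R id e := by
  classical
  let V : Finset M := E.biUnion Finsupp.support
  obtain ⟨c, hc⟩ : ∃ c : M → ℕ, Set.InjOn c V :=
    Set.countable_iff_exists_injOn.1 V.finite_toSet.countable
  have hs : ∀ e ∈ E, ∀ x ∈ e.support, x ∈ V := fun e he x hx =>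
    Finset.mem_biUnion.2 ⟨e, he, hx⟩
  have key : ∀ (v : ℕ → M) (e : M →₀ R),
      Finsupp.linearCombination R v (e.mapDomain c) = Finsupp.linearCombination R (v ∘ c) e :=
    fun v e => Finsupp.linearCombination_mapDomain R c e
  obtain ⟨v, hvN, hv⟩ := hN
    (E.image fun e => (e.mapDomain c, Finsupp.linearCombination R id e))
    (by simpa using hE) (by
      refine ⟨Function.invFunOn c V, fun e h => ?_⟩
      obtain ⟨e, he, rfl⟩ := Finset.mem_image.1 h
      rw [key, Finsupp.linearCombination_apply]
      change _ = Finsupp.linearCombination R id e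
      rw [Finsupp.linearCombination_apply]
      refine Finsupp.sum_congr fun x hx => ?_
      rw [Function.comp_apply, hc.leftInvOn_invFunOn (hs e he x hx), id])
  refine ⟨v ∘ c, fun x => hvN _, fun e he => ?_⟩
  rw [← key]
  exact hv _ (Finset.mem_image_of_mem _ he)

/-- Indices `j` are finite sets of formal combinations with value in `N`, and `h j : M → N`
preserves the values of those in `j`. Modulo eventually zero families the `h j` become a linear map
`g`, since combinations with value `0` are among those preserved. It agrees with the diagonal `d`
exactly on `N`. -/
lemma IsClosedUnderConstructions.of_isPureSubmodule {P : ObjectProperty (ModuleCat.{u} R)}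
    (hP : IsClosedUnderConstructions P) (hM : P (ModuleCat.of R M)) {N : Submodule R M}
    (hN : IsPureSubmodule N) : P (ModuleCat.of R N) := by
  classical
  let K := {e : M →₀ R // Finsupp.linearCombination R id e ∈ N}
  let J := Finset K
  have hex (j : J) : ∃ h : M → M, (∀ x, h x ∈ N) ∧ ∀ e ∈ j,
      Finsupp.linearCombination R h e.1 = Finsupp.linearCombination R id e.1 := by
    obtain ⟨h, h₁, h₂⟩ := hN.exists_solution (j.image Subtype.val) (by
      intro e he
      obtain ⟨e, -, rfl⟩ := Finset.mem_image.1 he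
      exact e.2)
    exact ⟨h, h₁, fun e he => h₂ _ (Finset.mem_image_of_mem _ he)⟩
  choose h hhN hh using hex
  let Q := (J → M) ⧸ eventuallyZero R M J
  have hh' (e : M →₀ R) (he : Finsupp.linearCombination R id e ∈ N) (j : J) (hj : {⟨e, he⟩} ≤ j) :
      Finsupp.linearCombination R (h j) e = Finsupp.linearCombination R id e :=
    hh j ⟨e, he⟩ (hj (Finset.mem_singleton_self _))
  let d : M →ₗ[R] Q := (eventuallyZero R M J).mkQ ∘ₗ LinearMap.pi fun _ => LinearMap.id
  let g : M →ₗ[R] Q :=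
    { toFun x := (eventuallyZero R M J).mkQ fun j => h j x
      map_add' x y := by
        rw [← map_add, ← sub_eq_zero, ← map_sub]
        have hl : Finsupp.linearCombination R id
            (Finsupp.single (x + y) (1 : R) - Finsupp.single x 1 - Finsupp.single y 1) = 0 := by
          simp
        refine (Submodule.Quotient.mk_eq_zero _).2 ⟨{⟨_, hl ▸ N.zero_mem⟩}, fun j hj => ?_⟩
        have := hh' _ _ j hj
        rw [hl] at this
        simpa [sub_sub] using this
      map_smul' r x := by
        rw [RingHom.id_apply, ← map_smul, ← sub_eq_zero, ← map_sub]
        have hl : Finsupp.linearCombination R id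
            (Finsupp.single (r • x) (1 : R) - Finsupp.single x r) = 0 := by
          simp
        refine (Submodule.Quotient.mk_eq_zero _).2 ⟨{⟨_, hl ▸ N.zero_mem⟩}, fun j hj => ?_⟩
        have := hh' _ _ j hj
        rw [hl] at this
        simpa using this }
  have hgd : LinearMap.eqLocus g d = N := by
    ext x
    rw [LinearMap.mem_eqLocus, ← sub_eq_zero]
    change (eventuallyZero R M J).mkQ (fun j => h j x) -
      (eventuallyZero R M J).mkQ (fun _ => x) = 0 ↔ _
    rw [← map_sub, Submodule.mkQ_apply, Submodule.Quotient.mk_eq_zero]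
    constructor
    · rintro ⟨j, hj⟩
      have hx : h j x = x := sub_eq_zero.1 (hj j le_rfl)
      exact hx ▸ hhN j x
    · intro hx
      have hl : Finsupp.linearCombination R id (Finsupp.single x (1 : R)) = x := by simp
      refine ⟨{⟨_, hl.symm ▸ hx⟩}, fun j hj => ?_⟩
      have := hh' _ _ j hj
      rw [hl] at this
      simpa [sub_eq_zero] using this
  exact hP.equiv (LinearEquiv.ofEq _ _ hgd) (hP.eqLocus g d hM (hP.reducedPower hM))

end Pure

/-! ### The solution set and the initial pointed module. -/

section WeaklyInitial

variable (R : Type u) [Ring R]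

/-- Formal terms of depth `n`: a term is a constant, a term of smaller depth, or the `i`-th entry of
a chosen solution of a finite system of linear equations whose constants are combinations of terms
of smaller depth. -/
def SolutionTerm : ℕ → Type u
  | 0 => PUnit
  | n + 1 => SolutionTerm n ⊕ Finset ((ℕ →₀ R) × (SolutionTerm n →₀ R)) × ℕ

variable {R} {M : Type u} [AddCommGroup M] [Module R M]

open Classical in
/-- Evaluation of formal terms in a module, given the value of the constant. -/
noncomputable def SolutionTerm.eval (x : M) : ∀ n, SolutionTerm R n → M
  | 0 => fun _ => x
  | n + 1 => Sum.elim (SolutionTerm.eval x n) fun E =>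
      -- Unsolvable systems get the value `0`, so that the type of terms depends only on `R` and not
      -- on `M`.
      if h : ∃ v : ℕ → M, ∀ e ∈ E.1, Finsupp.linearCombination R v e.1 =
          Finsupp.linearCombination R (SolutionTerm.eval x n) e.2 then
        h.choose E.2
      else 0

/-- The linear combinations of values of terms of depth `n`. -/
noncomputable def termSpan (R : Type u) [Ring R] {M : Type u} [AddCommGroup M] [Module R M] (x : M)
    (n : ℕ) : Submodule R M :=
  LinearMap.range (Finsupp.linearCombination R (SolutionTerm.eval (R := R) x n))

lemma termSpan_mono (x : M) : Monotone (termSpan R x) := by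
  refine monotone_nat_of_le_succ fun n => ?_
  rw [termSpan, termSpan, Finsupp.range_linearCombination, Finsupp.range_linearCombination]
  refine Submodule.span_mono ?_
  rintro _ ⟨t, rfl⟩
  exact ⟨Sum.inl t, rfl⟩

lemma eval_mem_termSpan (x : M) (n : ℕ) (t : SolutionTerm R n) :
    SolutionTerm.eval x n t ∈ termSpan R x n :=
  ⟨Finsupp.single t 1, by simp⟩

/-- The constants of a finite system already occur at one depth `n`, and the entries of its chosen
solution are terms of depth `n + 1`. -/
lemma isPureSubmodule_iSup_termSpan (x : M) : IsPureSubmodule (⨆ n, termSpan R x n) := by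
  classical
  intro E hE hv
  have hdir := (termSpan_mono (R := R) x).directed_le
  have hn : ∃ n, ∀ e ∈ E, e.2 ∈ termSpan R x n := by
    choose! n hn using fun e he => (Submodule.mem_iSup_of_directed _ hdir).1 (hE e he)
    exact ⟨E.sup n, fun e he => termSpan_mono x (Finset.le_sup he) (hn e he)⟩
  obtain ⟨n, hn⟩ := hn
  choose! c hc using hn
  let F : Finset ((ℕ →₀ R) × (SolutionTerm R n →₀ R)) := E.image fun e => (e.1, c e)
  have hF : ∃ v : ℕ → M, ∀ e ∈ F, Finsupp.linearCombination R v e.1 =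
      Finsupp.linearCombination R (SolutionTerm.eval x n) e.2 := by
    obtain ⟨v, hv⟩ := hv
    refine ⟨v, fun e h => ?_⟩
    obtain ⟨e, he, rfl⟩ := Finset.mem_image.1 h
    exact (hv e he).trans (hc e he).symm
  refine ⟨hF.choose, fun i => ?_, fun e he => ?_⟩
  · have h : SolutionTerm.eval (R := R) x (n + 1) (Sum.inr (F, i)) = hF.choose i := by
      change (if h : _ then _ else _) = _
      rw [dif_pos hF]
    exact Submodule.mem_iSup_of_mem (n + 1) (h ▸ eval_mem_termSpan x (n + 1) _)
  · exact (hF.choose_spec _ (Finset.mem_image_of_mem _ he)).trans (hc e he)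

/-- This presents the pure submodule around `x` as a quotient of a free module independent of `M`
and `x`. -/
lemma range_linearCombination_eval (x : M) :
    LinearMap.range (Finsupp.linearCombination R
      fun t : Σ n, SolutionTerm R n => SolutionTerm.eval x t.1 t.2) = ⨆ n, termSpan R x n := by
  rw [Finsupp.range_linearCombination]
  refine le_antisymm (Submodule.span_le.2 ?_) (iSup_le fun n => ?_)
  · rintro _ ⟨t, rfl⟩
    exact Submodule.mem_iSup_of_mem t.1 (eval_mem_termSpan x t.1 t.2)
  · rw [termSpan, Finsupp.range_linearCombination]
    refine Submodule.span_mono ?_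
    rintro _ ⟨t, rfl⟩
    exact ⟨⟨n, t⟩, rfl⟩

lemma IsClosedUnderConstructions.exists_weaklyInitial {P : ObjectProperty (ModuleCat.{u} R)}
    (hP : IsClosedUnderConstructions P) :
    ∃ (W : ModuleCat.{u} R) (w : W), P W ∧
      ∀ (M : ModuleCat.{u} R) (x : M), P M → ∃ φ : W →ₗ[R] M, φ w = x := by
  let F := (Σ n, SolutionTerm R n) →₀ R
  -- The quotients of the fixed module `F` that lie in `P` form a small set; their product is weakly
  -- initial.
  let I := {K : Submodule R F // P (ModuleCat.of R (F ⧸ K))}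
  let t₀ : Σ n, SolutionTerm R n := ⟨0, PUnit.unit⟩
  let G (i : I) : Type u := F ⧸ i.1
  let _ (i : I) : AddCommGroup (G i) := inferInstanceAs (AddCommGroup (F ⧸ i.1))
  let _ (i : I) : Module R (G i) := inferInstanceAs (Module R (F ⧸ i.1))
  refine ⟨ModuleCat.of R (∀ i : I, G i),
    fun i => i.1.mkQ (Finsupp.single t₀ 1), hP.pi G fun i => i.2, fun M x hM => ?_⟩
  let q : F →ₗ[R] M :=
    Finsupp.linearCombination R fun t : Σ n, SolutionTerm R n => SolutionTerm.eval x t.1 t.2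
  have hq : P (ModuleCat.of R (F ⧸ LinearMap.ker q)) := by
    refine hP.equiv q.quotKerEquivRange.symm ?_
    exact hP.equiv (LinearEquiv.ofEq _ _ (range_linearCombination_eval x).symm)
      (hP.of_isPureSubmodule hM (isPureSubmodule_iSup_termSpan x))
  let i : I := ⟨LinearMap.ker q, hq⟩
  refine ⟨(LinearMap.ker q).liftQ q le_rfl ∘ₗ (LinearMap.proj i : _ →ₗ[R] G i), ?_⟩
  change (LinearMap.ker q).liftQ q le_rfl (Submodule.Quotient.mk (Finsupp.single t₀ 1)) = x
  rw [Submodule.liftQ_apply]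
  exact (Finsupp.linearCombination_single R _ _).trans (one_smul R _)

/-- The reflection of the free module of rank one. -/
lemma IsClosedUnderConstructions.exists_initial {P : ObjectProperty (ModuleCat.{u} R)}
    (hP : IsClosedUnderConstructions P) :
    ∃ (W : ModuleCat.{u} R) (w : W), P W ∧
      ∀ (M : ModuleCat.{u} R) (x : M), P M → ∃! φ : W →ₗ[R] M, φ w = x := by
  obtain ⟨V, v, hV, hinit⟩ := hP.exists_weaklyInitial
  let I := {K : Submodule R V // P (ModuleCat.of R K) ∧ v ∈ K}
  let W : Submodule R V := ⨅ i : I, i.1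
  have hv : v ∈ W := (Submodule.mem_iInf _).2 fun i => i.2.2
  refine ⟨ModuleCat.of R W, ⟨v, hv⟩, hP.iInf _ (fun i => i.2.1) hV, fun M x hM => ?_⟩
  have hW : P (ModuleCat.of R W) := hP.iInf _ (fun i => i.2.1) hV
  obtain ⟨φ, hφ⟩ := hinit M x hM
  refine ⟨φ ∘ₗ W.subtype, hφ, fun ψ hψ => LinearMap.ext fun y => ?_⟩
  let E := LinearMap.eqLocus ψ (φ ∘ₗ W.subtype)
  -- The equalizer of two maps agreeing at `v` is one of the submodules intersected to form `W`, so
  -- it is all of `W`.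
  have hE : P (ModuleCat.of R (E.map W.subtype)) :=
    hP.equiv (E.equivMapOfInjective W.subtype W.subtype_injective)
      (hP.eqLocus _ _ hW hM)
  have hvE : v ∈ E.map W.subtype := ⟨⟨v, hv⟩, hψ.trans hφ.symm, rfl⟩
  obtain ⟨y', hy', h⟩ := (Submodule.mem_iInf _).1 y.2 (⟨_, hE, hvE⟩ : I)
  obtain rfl : y' = y := Subtype.ext h
  exact hy'

end WeaklyInitial

/-! ### The ring structure on the reflection and the equivalence. -/

section Ring

variable {A : Type u} [Ring A] {Y : ObjectProperty (ModuleCat.{u} Aᵐᵒᵖ)}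

/-- The element `1` of `B` as a right `A`-module. -/
def rightOne {B : Type u} [Ring B] (f : A →+* B) : rightModule f := (1 : B)

/-- The pair `(B_A, 1)` is initial among modules in `Y` with a chosen element. -/
structure IsReflection (Y : ObjectProperty (ModuleCat.{u} Aᵐᵒᵖ)) {B : Type u} [Ring B]
    (f : A →+* B) : Prop where
  prop : Y (rightModule f)
  existsUnique (M : ModuleCat.{u} Aᵐᵒᵖ) (x : M) (hM : Y M) :
    ∃! φ : rightModule f →ₗ[Aᵐᵒᵖ] M, φ (rightOne f) = x

/-- A module that is initial among the pointed modules in `Y` is a ring. -/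
lemma exists_isReflection (h : ∃ (W : ModuleCat.{u} Aᵐᵒᵖ) (w : W), Y W ∧
      ∀ (M : ModuleCat.{u} Aᵐᵒᵖ) (x : M), Y M → ∃! φ : W →ₗ[Aᵐᵒᵖ] M, φ w = x)
    [Y.IsClosedUnderIsomorphisms] :
    ∃ (B : Type u) (_ : Ring B) (f : A →+* B), IsReflection Y f := by
  obtain ⟨W, w, hW, hinit⟩ := h
  choose φ hφ huniq using fun x : W => hinit W x hW
  have hφ' (x : W) : φ x w = x := hφ x
  have ext {α β : W →ₗ[Aᵐᵒᵖ] W} (h : α w = β w) : α = β :=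
    (huniq _ α h).trans (huniq _ β rfl).symm
  -- The product `x * y` is `φ x y`, which transports composition of endomorphisms along `x ↦ φ x`.
  -- Axioms not immediate from linearity compare two endomorphisms at `w`.
  let ring : Ring W :=
    { (inferInstance : AddCommGroup W) with
      mul x y := φ x y
      one := w
      left_distrib x y z := map_add (φ x) y z
      right_distrib x y z := by
        change φ (x + y) z = φ x z + φ y z
        rw [ext (α := φ (x + y)) (β := φ x + φ y) (by simp [hφ']), LinearMap.add_apply]
      zero_mul x := by
        change φ 0 x = 0
        rw [ext (α := φ 0) (β := 0) (by simp [hφ']), LinearMap.zero_apply]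
      mul_zero x := map_zero (φ x)
      mul_assoc x y z := by
        change φ (φ x y) z = φ x (φ y z)
        rw [ext (α := φ (φ x y)) (β := φ x ∘ₗ φ y) (by simp [hφ']), LinearMap.comp_apply]
      one_mul x := by
        change φ w x = x
        rw [ext (α := φ w) (β := LinearMap.id) (by simp [hφ']), LinearMap.id_apply]
      mul_one x := hφ x }
  let f : A →+* W :=
    { toFun a := MulOpposite.op a • w
      map_one' := one_smul _ w
      map_zero' := zero_smul _ w
      map_add' a b := add_smul _ _ w
      map_mul' a b := by
        change MulOpposite.op (a * b) • w = φ (MulOpposite.op a • w) (MulOpposite.op b • w)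
        rw [map_smul, hφ', MulOpposite.op_mul, mul_smul] }
  -- The original action agrees with restriction along `f`, because `φ x` is `A`-linear and sends
  -- `w` to `x`.
  let e : W ≃ₗ[Aᵐᵒᵖ] rightModule f :=
    { toFun x := x
      invFun x := x
      map_add' _ _ := rfl
      map_smul' a x := by
        change a • x = φ x (MulOpposite.op a.unop • w)
        rw [map_smul, hφ', MulOpposite.op_unop]
      left_inv _ := rfl
      right_inv _ := rfl }
  refine ⟨W, ring, f, Y.prop_of_iso e.toModuleIso hW, fun M x hM => ?_⟩
  obtain ⟨ψ, hψ, hu⟩ := hinit M x hM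
  refine ⟨ψ ∘ₗ e.symm.toLinearMap, hψ, fun χ hχ => ?_⟩
  rw [← hu (χ ∘ₗ e.toLinearMap) hχ]
  rfl

namespace IsReflection

variable {B : Type u} [Ring B] {f : A →+* B}

lemma hom_ext (h : IsReflection Y f) {M : ModuleCat.{u} Aᵐᵒᵖ} (hM : Y M)
    {α β : rightModule f →ₗ[Aᵐᵒᵖ] M} (hαβ : α (rightOne f) = β (rightOne f)) : α = β :=
  (h.existsUnique M _ hM).unique hαβ rfl

/-- The linear map from `B` sending `1` to an element of a `B`-module. -/
noncomputable def toRestriction (f : A →+* B) (M : ModuleCat.{u} Bᵐᵒᵖ) (m : M) :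
    rightModule f →ₗ[Aᵐᵒᵖ] (restriction f).obj M :=
  ((restriction f).map (ModuleCat.ofHom
    ((LinearMap.toSpanSingleton Bᵐᵒᵖ M m) ∘ₗ
      (MulOpposite.opLinearEquiv Bᵐᵒᵖ : B ≃ₗ[Bᵐᵒᵖ] Bᵐᵒᵖ).toLinearMap))).hom

lemma toRestriction_rightOne (M : ModuleCat.{u} Bᵐᵒᵖ) (m : M) :
    toRestriction f M m (rightOne f) = m := one_smul Bᵐᵒᵖ m

/-- Every right `B`-module lies in `Y`, being a cokernel of a map between free modules. -/
lemma prop_restriction (h : IsReflection Y f) (hY : IsClosedUnderConstructions Y)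
    (M : ModuleCat.{u} Bᵐᵒᵖ) : Y ((restriction f).obj M) := by
  let s (X : ModuleCat.{u} Bᵐᵒᵖ) : (X →₀ rightModule f) →ₗ[Aᵐᵒᵖ] (restriction f).obj X :=
    Finsupp.lsum ℕ fun x => toRestriction f X x
  have hs (X : ModuleCat.{u} Bᵐᵒᵖ) : Function.Surjective (s X) := fun x =>
    ⟨Finsupp.single x (1 : B), (Finsupp.lsum_single _ _ _ _).trans (one_smul Bᵐᵒᵖ (x : X))⟩
  have hfree (X : ModuleCat.{u} Bᵐᵒᵖ) : Y (ModuleCat.of Aᵐᵒᵖ (X →₀ rightModule f)) :=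
    hY.finsupp X h.prop
  let F : ModuleCat.{u} Bᵐᵒᵖ := ModuleCat.of Bᵐᵒᵖ (M →₀ B)
  let p : F →ₗ[Bᵐᵒᵖ] M := Finsupp.lsum ℕ fun x => LinearMap.toSpanSingleton Bᵐᵒᵖ M x ∘ₗ
      (MulOpposite.opLinearEquiv Bᵐᵒᵖ : B ≃ₗ[Bᵐᵒᵖ] Bᵐᵒᵖ).toLinearMap
  let p' : (restriction f).obj F →ₗ[Aᵐᵒᵖ] (restriction f).obj M :=
    ((restriction f).map (ModuleCat.ofHom p)).hom
  have hp : Function.Surjective p := fun x =>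
    ⟨Finsupp.single x (1 : B), (Finsupp.lsum_single _ _ _ _).trans (one_smul Bᵐᵒᵖ x)⟩
  have hp' : Function.Surjective p' := hp
  let e : (M →₀ rightModule f) ≃ₗ[Aᵐᵒᵖ] (restriction f).obj F :=
    { toFun x := x
      invFun x := x
      map_add' _ _ := rfl
      map_smul' a x := rfl
      left_inv _ := rfl
      right_inv _ := rfl }
  have hF : Y ((restriction f).obj F) := by
    have := hY.equiv e (hfree M)
    exact this
  let K : ModuleCat.{u} Bᵐᵒᵖ := ModuleCat.of Bᵐᵒᵖ (LinearMap.ker p)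
  let i : (restriction f).obj K →ₗ[Aᵐᵒᵖ] (restriction f).obj F :=
    ((restriction f).map (ModuleCat.ofHom (LinearMap.ker p).subtype)).hom
  -- The kernel `K` is not known to lie in `Y`; covering it by copies of `B` makes `M` a cokernel of
  -- a map inside `Y`.
  have hi : LinearMap.range (i ∘ₗ s K) = LinearMap.ker p' := by
    rw [LinearMap.range_comp_of_range_eq_top _ (LinearMap.range_eq_top.2 (hs K))]
    ext x
    exact ⟨fun ⟨y, hy⟩ => hy ▸ y.2, fun hx => ⟨⟨x, hx⟩, rfl⟩⟩
  have := hY.equiv ((Submodule.quotEquivOfEq _ _ hi).trans (p'.quotKerEquivOfSurjective hp'))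
    (hY.quotient_range (i ∘ₗ s K) (hfree K) hF)
  exact this

/-- Both sides are `A`-linear in `b` as maps from `B` to `N`, and they agree at `1`. -/
lemma map_smul (h : IsReflection Y f) (hY : IsClosedUnderConstructions Y)
    {M N : ModuleCat.{u} Bᵐᵒᵖ} (g : (restriction f).obj M →ₗ[Aᵐᵒᵖ] (restriction f).obj N)
    (b : Bᵐᵒᵖ) (m : M) : g (b • m : M) = (b • (g m : N) : N) := by
  have key : g ∘ₗ toRestriction f M m = toRestriction f N (g m) :=
    h.hom_ext (h.prop_restriction hY N) (by
      rw [LinearMap.comp_apply, toRestriction_rightOne]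
      exact (toRestriction_rightOne N (g m)).symm)
  exact congr($key (b.unop : B))

lemma isEquivalence (h : IsReflection Y f) (hY : IsClosedUnderConstructions Y) :
    (Y.lift (restriction f) (h.prop_restriction hY)).IsEquivalence where
  faithful := ⟨fun {M N g g'} hg => by
    have h' : (restriction f).map g = (restriction f).map g' := congr(($hg).hom)
    exact (restriction f).map_injective h'⟩
  full := ⟨fun {M N} g => by
    let g' : (restriction f).obj M →ₗ[Aᵐᵒᵖ] (restriction f).obj N := g.hom.hom
    exact ⟨ModuleCat.ofHom
      { toFun := g'
        map_add' := map_add g'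
        map_smul' := h.map_smul hY g' }, rfl⟩⟩
  essSurj := ⟨fun X => by
    let X' := X.obj
    choose φ hφ huniq using fun x : X' => h.existsUnique X' x X.property
    have hφ' (x : X') : φ x (rightOne f) = x := hφ x
    have ext {α β : rightModule f →ₗ[Aᵐᵒᵖ] X'} (hαβ : α (rightOne f) = β (rightOne f)) : α = β :=
      h.hom_ext X.property hαβ
    -- `B` acts by `x · b = φ x b`; the axioms again come from uniqueness of maps out of `B`.
    let mod : Module Bᵐᵒᵖ X' :=
      { smul b x := φ x b.unop
        one_smul x := hφ x
        mul_smul b c x := by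
          change φ x (c.unop * b.unop : B) = φ (φ x c.unop) b.unop
          have := ext (α := φ x ∘ₗ toRestriction f (ModuleCat.of Bᵐᵒᵖ B) c.unop)
            (β := φ (φ x c.unop)) (by
              rw [hφ']
              exact congr(φ x $(toRestriction_rightOne (ModuleCat.of Bᵐᵒᵖ B) c.unop)))
          exact congr($this (b.unop : B))
        smul_zero b := by
          change φ 0 b.unop = 0
          rw [ext (α := φ 0) (β := 0) (by rw [hφ']; rfl)]
          rfl
        smul_add b x y := by
          change φ (x + y) b.unop = φ x b.unop + φ y b.unop
          rw [ext (α := φ (x + y)) (β := φ x + φ y)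
            (by rw [LinearMap.add_apply, hφ', hφ', hφ'])]
          rfl
        add_smul b c x := map_add (φ x) b.unop c.unop
        zero_smul x := map_zero (φ x) }
    let M : ModuleCat.{u} Bᵐᵒᵖ := ModuleCat.of Bᵐᵒᵖ X'
    let e : (restriction f).obj M ≃ₗ[Aᵐᵒᵖ] X' :=
      { toFun x := x
        invFun x := x
        map_add' _ _ := rfl
        map_smul' a x := by
          refine Eq.trans ?_ ((_root_.map_smul (φ x) a (rightOne f)).trans (congrArg (fun z : X' => a • z) (hφ' x)))
          exact congr(φ x $((one_mul (f a.unop)).symm))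
        left_inv _ := rfl
        right_inv _ := rfl }
    exact ⟨M, ⟨Y.isoMk e.toModuleIso⟩⟩⟩

end IsReflection

end Ring

/-! ### Tensor-hom adjunction. -/

section TensorHom

variable {A B : Type u} [Ring A] [Ring B]

/-- The right `B`-module of additive maps from `B` to an abelian group, with
`(φ · b) x = φ (b x)`. -/
noncomputable def homModule (B : Type u) [Ring B] (T : Type u) [AddCommGroup T] :
    ModuleCat.{u} Bᵐᵒᵖ :=
  let _ : Module Bᵐᵒᵖ (B →+ T) :=
    { smul b φ := φ.comp (AddMonoidHom.mulLeft b.unop)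
      one_smul φ := AddMonoidHom.ext fun x => congr(φ $(one_mul x))
      mul_smul b c φ := AddMonoidHom.ext fun x => congr(φ $(mul_assoc c.unop b.unop x))
      smul_zero _ := rfl
      smul_add _ _ _ := rfl
      add_smul b c φ := AddMonoidHom.ext fun x =>
        (congr(φ $(add_mul b.unop c.unop x))).trans (map_add φ _ _)
      zero_smul φ := AddMonoidHom.ext fun x => (congr(φ $(zero_mul x))).trans (map_zero φ) }
  ModuleCat.of Bᵐᵒᵖ (B →+ T)

/-- An element of the restriction of `homModule B T` as an additive map. -/
def homModule.toAddMonoidHom (f : A →+* B) {T : Type u} [AddCommGroup T]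
    (φ : (restriction f).obj (homModule B T)) : B →+ T := φ

variable (f : A →+* B) {T : Type u} [AddCommGroup T] {M : ModuleCat.{u} Aᵐᵒᵖ}

/-- The class of `m ⊗ x` in `M ⊗_A B`. -/
noncomputable def Tensor.tmul (m : M) (x : B) : Tensor M (leftModule f) :=
  Submodule.Quotient.mk (m ⊗ₜ[ℤ] (x : leftModule f))

lemma Tensor.smul_tmul (a : Aᵐᵒᵖ) (m : M) (x : B) :
    Tensor.tmul f (a • m) x = Tensor.tmul f m (f a.unop * x) :=
  (Submodule.Quotient.eq _).2 (Submodule.subset_span ⟨m, a.unop, x, rfl⟩)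

lemma Tensor.add_tmul (m m' : M) (x : B) :
    Tensor.tmul f (m + m') x = Tensor.tmul f m x + Tensor.tmul f m' x :=
  congrArg Submodule.Quotient.mk (TensorProduct.add_tmul m m' (x : leftModule f))

lemma Tensor.tmul_add (m : M) (x y : B) :
    Tensor.tmul f m (x + y) = Tensor.tmul f m x + Tensor.tmul f m y :=
  congrArg Submodule.Quotient.mk (TensorProduct.tmul_add m (x : leftModule f) y)

/-- Additive maps out of `M ⊗_A B` give linear maps from `M` to `Hom_ℤ(B, T)`. -/
noncomputable def tensorCurry (β : Tensor M (leftModule f) →ₗ[ℤ] T) :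
    M →ₗ[Aᵐᵒᵖ] (restriction f).obj (homModule B T) where
  toFun m := AddMonoidHom.mk' (fun x => β (Tensor.tmul f m x)) fun x y => by
    rw [Tensor.tmul_add, map_add]
  map_add' m m' := AddMonoidHom.ext fun x =>
    (congr(β $(Tensor.add_tmul f m m' x))).trans (map_add β _ _)
  map_smul' a m := AddMonoidHom.ext fun x => congr(β $(Tensor.smul_tmul f a m x))

variable {f} in
/-- Linear maps from `M` to `Hom_ℤ(B, T)` give additive maps out of `M ⊗_A B`. -/
noncomputable def tensorUncurry (γ : M →ₗ[Aᵐᵒᵖ] (restriction f).obj (homModule B T)) :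
    Tensor M (leftModule f) →ₗ[ℤ] T :=
  Submodule.liftQ _ (TensorProduct.lift
    (LinearMap.mk₂ ℤ (fun (m : M) (x : leftModule f) => homModule.toAddMonoidHom f (γ m) x)
      (fun m m' x => congrArg (fun φ : B →+ T => φ x) (map_add γ m m'))
      (fun k m x => congrArg (fun φ : B →+ T => φ x) (map_zsmul γ k m))
      (fun m x y => map_add (homModule.toAddMonoidHom f (γ m)) x y)
      (fun k m x => map_zsmul (homModule.toAddMonoidHom f (γ m)) k x))) (by
    refine Submodule.span_le.2 ?_
    rintro _ ⟨m, a, x, rfl⟩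
    refine LinearMap.mem_ker.2 ((map_sub _ _ _).trans (sub_eq_zero.2 ?_))
    exact congrArg (fun φ : B →+ T => φ x) (_root_.map_smul γ (MulOpposite.op a) m))

end TensorHom

/-! ### The homological epimorphism property. -/

namespace IsReflection

variable {A B : Type u} [Ring A] [Ring B] {f : A →+* B} {Y : ObjectProperty (ModuleCat.{u} Aᵐᵒᵖ)}

/-- As functions of `b`, both sides are `A`-linear maps from `B` to `Hom_ℤ(B, B ⊗_A B)`, a module in
`Y`, and they agree at `b = 1`. -/
lemma tmul_eq (h : IsReflection Y f) (hY : IsClosedUnderConstructions Y) (b x : B) :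
    (Tensor.tmul f (M := rightModule f) b x) = Tensor.tmul f (rightOne f) (b * x) := by
  let T := Tensor (rightModule f) (leftModule f)
  let α : rightModule f →ₗ[Aᵐᵒᵖ] (restriction f).obj (homModule B T) :=
    tensorCurry f LinearMap.id
  have key : α = toRestriction f (homModule B T) (α (rightOne f)) :=
    h.hom_ext (h.prop_restriction hY _) (toRestriction_rightOne _ _).symm
  exact congrArg (fun φ : B →+ T => φ x) congr($key b)

lemma bijective_multiplication (h : IsReflection Y f) (hY : IsClosedUnderConstructions Y) :
    Function.Bijective (multiplication f) := by
  constructor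
  · let s : B →ₗ[ℤ] Tensor (rightModule f) (leftModule f) :=
      (AddMonoidHom.mk' (Tensor.tmul f (rightOne f))
        (Tensor.tmul_add f (rightOne f))).toIntLinearMap
    have hs : s ∘ₗ multiplication f = LinearMap.id :=
      Tensor.hom_ext fun b x => (h.tmul_eq hY b x).symm
    exact Function.LeftInverse.injective (g := s) fun t => congr($hs t)
  · exact fun b => ⟨Tensor.tmul f (rightOne f) b, one_mul b⟩

/-- Extensions of `B` by modules in `Y` split. -/
lemma exists_extension [Y.IsClosedUnderExtensions] (h : IsReflection Y f)
    {E : ModuleCat.{u} Aᵐᵒᵖ} (hE : Y E) {M₁ M₀ : ModuleCat.{u} Aᵐᵒᵖ}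
    (d : M₁ →ₗ[Aᵐᵒᵖ] M₀) (ε : M₀ →ₗ[Aᵐᵒᵖ] rightModule f) (hε : Function.Surjective ε)
    (hd : LinearMap.ker ε = LinearMap.range d) (c : M₁ →ₗ[Aᵐᵒᵖ] E)
    (hc : LinearMap.ker d ≤ LinearMap.ker c) :
    ∃ g : M₀ →ₗ[Aᵐᵒᵖ] E, g ∘ₗ d = c := by
  have hεd (p : M₁) : ε (d p) = 0 := by
    have : d p ∈ LinearMap.ker ε := hd ▸ LinearMap.mem_range_self d p
    exact this
  -- `W` is the pushout of `c` and `d`, an extension of `B` by `E`; `hc` makes `i` injective.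
  let K : Submodule Aᵐᵒᵖ (E × M₀) := LinearMap.range (c.prod (-d))
  let W := (E × M₀) ⧸ K
  let i : E →ₗ[Aᵐᵒᵖ] W := K.mkQ ∘ₗ LinearMap.inl _ _ _
  let j : M₀ →ₗ[Aᵐᵒᵖ] W := K.mkQ ∘ₗ LinearMap.inr _ _ _
  have hij (p : M₁) : i (c p) = j (d p) :=
    (Submodule.Quotient.eq K).2 ⟨p, by simp⟩
  let q : W →ₗ[Aᵐᵒᵖ] rightModule f := K.liftQ (ε ∘ₗ LinearMap.snd _ _ _) (by
    rintro _ ⟨p, rfl⟩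
    simp [hεd])
  have hqi (e : E) : q (i e) = 0 := map_zero ε
  have hqj (m : M₀) : q (j m) = ε m := rfl
  have hi : Function.Injective i := by
    refine (injective_iff_map_eq_zero i).2 fun e he => ?_
    obtain ⟨p, hp⟩ := (Submodule.Quotient.mk_eq_zero K).1 he
    obtain ⟨h₁, h₂⟩ := Prod.ext_iff.1 hp
    have hp : p ∈ LinearMap.ker d := neg_eq_zero.1 h₂
    exact h₁.symm.trans (hc hp)
  have hq : Function.Surjective q := fun b => by
    obtain ⟨m, hm⟩ := hε b
    exact ⟨j m, hm⟩
  have hker (w : W) (hw : q w = 0) : ∃ e, i e = w := by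
    obtain ⟨⟨e, m⟩, rfl⟩ := Submodule.Quotient.mk_surjective K w
    have hm : m ∈ LinearMap.ker ε := hw
    rw [hd] at hm
    obtain ⟨p, rfl⟩ := hm
    refine ⟨e + c p, (Submodule.Quotient.eq K).2 ⟨p, by simp⟩⟩
  let S : ShortComplex (ModuleCat.{u} Aᵐᵒᵖ) :=
    { X₁ := E
      X₂ := ModuleCat.of Aᵐᵒᵖ W
      X₃ := rightModule f
      f := ModuleCat.ofHom i
      g := ModuleCat.ofHom (Y := ↑(rightModule f)) q
      zero := ModuleCat.hom_ext (LinearMap.ext hqi) }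
  have hS : S.ShortExact :=
    { exact := S.moduleCat_exact_iff.2 hker
      mono_f := (ModuleCat.mono_iff_injective _).2 hi
      epi_g := (ModuleCat.epi_iff_surjective _).2 hq }
  have hW : Y (ModuleCat.of Aᵐᵒᵖ W) := Y.prop_X₂_of_shortExact hS hE h.prop
  obtain ⟨w, hw⟩ := hq (rightOne f)
  obtain ⟨φ, hφ, -⟩ := h.existsUnique (ModuleCat.of Aᵐᵒᵖ W) w hW
  have hqφ : q ∘ₗ φ = LinearMap.id := h.hom_ext h.prop ((congrArg q hφ).trans hw)
  -- Subtracting the splitting moves `j` into `E`, without changing it on the image of `d`, where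
  -- `ε` vanishes.
  let r : M₀ →ₗ[Aᵐᵒᵖ] W := j - φ ∘ₗ ε
  have hr (m : M₀) : r m ∈ LinearMap.range i := hker _ (by
    change q (j m - φ (ε m)) = 0
    rw [map_sub, hqj, sub_eq_zero]
    exact congr($hqφ.symm (ε m)))
  refine ⟨(LinearEquiv.ofInjective i hi).symm.toLinearMap ∘ₗ r.codRestrict _ hr,
    LinearMap.ext fun p => ?_⟩
  change (LinearEquiv.ofInjective i hi).symm ⟨r (d p), hr (d p)⟩ = c p
  rw [LinearEquiv.symm_apply_eq]
  refine Subtype.ext ?_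
  change j (d p) - φ (ε (d p)) = i (c p)
  rw [hεd, map_zero, sub_zero, hij]

/-- This is `Ext_A^(n+1)(B, E) = 0` on cocycles: degree one uses closure under extensions, higher
degrees use heredity. -/
lemma exists_coboundary [Y.IsClosedUnderExtensions] (h : IsReflection Y f)
    (hA : IsRightHereditary A) (P : ProjectiveResolution (rightModule f))
    {E : ModuleCat.{u} Aᵐᵒᵖ} (hE : Y E) (n : ℕ) (c : P.complex.X (n + 1) ⟶ E)
    (hc : P.complex.d (n + 2) (n + 1) ≫ c = 0) :
    ∃ g : P.complex.X n ⟶ E, P.complex.d (n + 1) n ≫ g = c := by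
  cases n with
  | zero =>
    have h₁ := ((ShortComplex.moduleCat_exact_iff_range_eq_ker _).1 (P.exact_succ 0))
    have h₀ := ((ShortComplex.moduleCat_exact_iff_range_eq_ker _).1
      (ShortComplex.exact_of_g_is_cokernel (ShortComplex.mk _ _ P.complex_d_comp_π_f_zero)
        P.isColimitCokernelCofork))
    obtain ⟨g, hg⟩ := h.exists_extension hE (P.complex.d 1 0).hom (P.π.f 0).hom
      ((ModuleCat.epi_iff_surjective _).1 inferInstance) h₀.symm c.hom (by
        refine h₁.symm.le.trans ?_
        rintro _ ⟨x, rfl⟩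
        exact congr(($hc).hom x))
    exact ⟨ModuleCat.ofHom g, ModuleCat.hom_ext hg⟩
  | succ n =>
    have := hA (rightModule f) E (n + 2) (by omega)
    exact (P.extMk_eq_zero_iff c (n + 3) rfl hc (n + 1) rfl).1 (Subsingleton.elim _ _)

lemma isZero_tor [Y.IsClosedUnderExtensions] (h : IsReflection Y f)
    (hY : IsClosedUnderConstructions Y) (hA : IsRightHereditary A) (n : ℕ) :
    IsZero (Tor (n + 1) (rightModule f) (leftModule f)) := by
  let P := projectiveResolution (rightModule f)
  refine IsZero.of_iso ?_ (P.isoLeftDerivedObj (tensorFunctor (leftModule f)) (n + 1))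
  refine (HomologicalComplex.exactAt_iff_isZero_homology _ _).1 ?_
  rw [HomologicalComplex.exactAt_iff' _ (n + 2) (n + 1) n (by simp) (by simp),
    ShortComplex.moduleCat_exact_iff]
  intro (t : Tensor (P.complex.X (n + 1)) (leftModule f)) ht
  let D := Tensor.map (P.complex.d (n + 2) (n + 1)) (leftModule f)
  let D' := Tensor.map (P.complex.d (n + 1) n) (leftModule f)
  -- The projection onto the cokernel of `D` corresponds to a cocycle in `Hom_ℤ(B, Q)`. Being a
  -- coboundary, it makes the projection factor through `D'`, so cycles die in `Q` and are
  -- boundaries.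
  let Q := Tensor (P.complex.X (n + 1)) (leftModule f) ⧸ LinearMap.range D
  let E := (restriction f).obj (homModule B Q)
  let c : P.complex.X (n + 1) ⟶ E :=
    ModuleCat.ofHom (Y := ↑((restriction f).obj (homModule B Q)))
      (tensorCurry f (LinearMap.range D).mkQ)
  have hc : P.complex.d (n + 2) (n + 1) ≫ c = 0 :=
    ModuleCat.hom_ext (LinearMap.ext fun m => AddMonoidHom.ext fun x =>
      (Submodule.Quotient.mk_eq_zero _).2 ⟨Tensor.tmul f m x, rfl⟩)
  obtain ⟨g, hg⟩ := h.exists_coboundary hA P (h.prop_restriction hY _) n c hc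
  have hgD : tensorUncurry g.hom ∘ₗ D' = (LinearMap.range D).mkQ :=
    Tensor.hom_ext fun m x => congrArg (fun φ : B →+ Q => φ x) congr(($hg).hom m)
  have ht' : D' t = 0 := ht
  have : (LinearMap.range D).mkQ t = 0 := by
    rw [← hgD, LinearMap.comp_apply, ht', map_zero]
  exact (Submodule.Quotient.mk_eq_zero _).1 this

end IsReflection

end HomologicalEpi

theorem proposition3p2 (A : Type u) [Ring A] (hA : HomologicalEpi.IsRightHereditary A)
    (Y : ObjectProperty (ModuleCat.{u} Aᵐᵒᵖ))
    (hY : HomologicalEpi.IsAbelianSubcategory Y)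
    (hext : Y.IsClosedUnderExtensions)
    (hprod : ∀ J : Type u, Y.IsClosedUnderLimitsOfShape (Discrete J))
    (hcoprod : ∀ J : Type u, Y.IsClosedUnderColimitsOfShape (Discrete J)) :
    ∃ (B : Type u) (_ : Ring B) (f : A →+* B),
      HomologicalEpi.IsHomologicalEpimorphism f ∧
      ∃ h : ∀ M : ModuleCat.{u} Bᵐᵒᵖ, Y ((HomologicalEpi.restriction f).obj M),
        (Y.lift (HomologicalEpi.restriction f) h).IsEquivalence := by
  have hY' := HomologicalEpi.isClosedUnderConstructions_of_isAbelianSubcategory hY hprod hcoprod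
  have := hY.isClosedUnderIsomorphisms
  obtain ⟨B, _, f, hf⟩ := HomologicalEpi.exists_isReflection hY'.exists_initial
  refine ⟨B, _, f, ⟨hf.bijective_multiplication hY', fun n hn => ?_⟩,
    hf.prop_restriction hY', hf.isEquivalence hY'⟩
  obtain ⟨n, rfl⟩ := Nat.exists_eq_succ_of_ne_zero hn.ne'
  exact hf.isZero_tor hY' hA n
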